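/- Let $\Gamma\subset\mathrm{Aut}(\mathbb D)$ be a cocompact Fuchsian group acting freely on the unit disc $\mathbb D$ (equivalently, $\Sigma=\mathbb D/\Gamma$ is a compact Riemann surface of genus $g\ge 2$ and $\Gamma\simeq\pi_1(\Sigma)$ acts by deck transformations). Let $(T,d_T)$ be a compact metric space, let $\rho\colon\Gamma\to\mathrm{Homeo}(T)$ be a representation, and let $X=(\mathbb D\times T)/\Gamma$ be the quotient by the diagonal action $\gamma\cdot(z,t)=(\gamma z,\rho(\gamma)t)$. Write $[z,t]$ for the class of $(z,t)$. The space $X$ is laminated by the images of the discs $\mathbb D\times\{t\}$; this lamination $\mathcal F$ is the suspension of $\rho$. Its flow boxes are the sets $[V\times T]\simeq V\times T$, where $V\subset\mathbb D$ is open, connected and disjoint from $\gamma V$ for every $\gamma\in\Gamma\setminus\{\mathrm{id}\}$. The suspension is called Lipschitz if $X$ has an atlas of such flow boxes all of whose transition maps $(z,t)\mapsto(w,s)$, $[z,t]=[w,s]$, are Lipschitz for the Euclidean metric on the disc factor and $d_T$ on $T$. Suppose that $X$ is embedded in a finite-dimensional smooth Riemannian manifold $M$, and let $d_X$ be the distance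 on $X$ induced by the Riemannian distance of $M$. Suppose that $d_T$ is the metric that $T$ inherits from $d_X$ as the distinguished transversal $\{[0,t]\,;\,t\in T\}\simeq T$, or, more generally, that there is a constant $C\ge 0$ with $d_T(t,s)\le C\,d_X([0,t],[0,s])$ for all $t,s\in T$. For $x\in X$, let $\phi_x\colon\mathbb D\to L_x$ be a uniformization of the leaf through $x$ with $\phi_x(0)=x$; that is, $\phi_x(\xi)=[\tau(\xi),t]$ for some $\tau\in\mathrm{Aut}(\mathbb D)$ and $t\in T$ with $[\tau(0),t]=x$. It is unique up to precomposition by a rotation. For $R>0$ let $\overline{\mathbb D}_R$ be the closed disc of centre $0$ and radius $R$ for the Poincaré distance, normalized by $d_P(0,\xi)=\log\frac{1+|\xi|}{1-|\xi|}$, and let $$d_R(x,y)=\inf_{\theta\in\mathbb R}\ \sup_{\xi\in\overline{\mathbb D}_R} d_X\big(\phi_x(\xi),\phi_y(e^{i\theta}\xi)\big),\qquad x,y\in X.$$ Let $N(X,R,\varepsilon)$ be the minimal number of balls $\{y\,;\,d_R(x_i,y)<\varepsilon\}$, $x_i\in X$, needed to cover $X$, and define the hyperbolic entropy of $\mathcal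 F$ by $$h(\mathcal F)=\sup_{\varepsilon>0}\ \limsup_{R\to+\infty}\frac1R\log N(X,R,\varepsilon).$$ If the suspension $\mathcal F$ is Lipschitz, then $h(\mathcal F)<+\infty$. -/

import Mathlib

open Complex Filter Topology Bundle
open scoped Complex.UnitDisc Manifold ContDiff ENNReal NNReal ComplexConjugate

noncomputable section

namespace HypSusp

/-! ### Automorphisms of the disc and surface groups -/

/-- A self-map of the unit disc is holomorphic: it is given by a function of the complex variable
which is complex differentiable on the open unit disc. -/
def IsHolo (f : 𝔻 → 𝔻) : Prop :=
  ∃ F : ℂ → ℂ, DifferentiableOn ℂ F (Metric.ball 0 1) ∧ ∀ z : 𝔻, (f z : ℂ) = F z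

theorem isHolo_id : IsHolo (fun z => z) :=
  ⟨fun z => z, differentiableOn_id, fun _ => rfl⟩

theorem IsHolo.comp {f g : 𝔻 → 𝔻} (hf : IsHolo f) (hg : IsHolo g) :
    IsHolo (fun z => f (g z)) := by
  obtain ⟨F, hF, hfF⟩ := hf
  obtain ⟨G, hG, hgG⟩ := hg
  refine ⟨fun z => F (G z), hF.comp hG ?_, fun z => by rw [hfF, hgG]⟩
  intro z hz
  have hz1 : ‖z‖ < 1 := by simpa using hz
  have h := hgG (UnitDisc.mk z hz1)
  rw [UnitDisc.coe_mk] at h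
  rw [← h]
  simpa using (g (UnitDisc.mk z hz1)).norm_lt_one

/-- The group `Aut(𝔻)` of biholomorphic self-maps of the unit disc. -/
def discAut : Subgroup (𝔻 ≃ₜ 𝔻) where
  carrier := {f | IsHolo f ∧ IsHolo f.symm}
  one_mem' := ⟨isHolo_id, isHolo_id⟩
  mul_mem' := fun hf hg => ⟨hf.1.comp hg.1, hg.2.comp hf.2⟩
  inv_mem' := fun hf => ⟨hf.2, hf.1⟩

/-- `Γ` is the deck transformation group of the uniformization `𝔻 → 𝔻/Γ = Σ` of a compact smooth
hyperbolic Riemann surface (that is, of genus at least two): a cocompact Fuchsian group acting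
freely on the disc. -/
structure IsSurfaceGroup (Γ : Subgroup (𝔻 ≃ₜ 𝔻)) : Prop where
  le_discAut : Γ ≤ discAut
  properlyDiscontinuous : ∀ K : Set 𝔻, IsCompact K → {γ ∈ Γ | (γ '' K ∩ K).Nonempty}.Finite
  free : ∀ γ ∈ Γ, ∀ z : 𝔻, γ z = z → γ = 1
  cocompact : ∃ K : Set 𝔻, IsCompact K ∧ ∀ z : 𝔻, ∃ γ ∈ Γ, γ z ∈ K

theorem norm_mobius_lt (a z : 𝔻) : ‖((z : ℂ) + a) / (1 + conj (a : ℂ) * z)‖ < 1 := by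
  have ha := a.normSq_lt_one
  have hz := z.normSq_lt_one
  have key : normSq (1 + conj (a : ℂ) * z) - normSq ((z : ℂ) + a)
      = (1 - normSq (a : ℂ)) * (1 - normSq (z : ℂ)) := by
    simp only [normSq_apply, add_re, add_im, mul_re, mul_im, conj_re, conj_im, one_re, one_im]
    ring
  have hpos : normSq ((z : ℂ) + a) < normSq (1 + conj (a : ℂ) * z) := by
    have : 0 < (1 - normSq (a : ℂ)) * (1 - normSq (z : ℂ)) :=
      mul_pos (by linarith) (by linarith)
    linarith
  rw [← sq_lt_one_iff₀ (norm_nonneg _), ← normSq_eq_norm_sq, normSq_div]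
  exact (div_lt_one (lt_of_le_of_lt (normSq_nonneg _) hpos)).2 hpos

theorem mobius_den_ne (a : 𝔻) (z : ℂ) (hz : ‖z‖ < 1) : 1 + conj (a : ℂ) * z ≠ 0 := by
  intro h
  have h1 : ‖conj (a : ℂ) * z‖ = 1 := by
    rw [show conj (a : ℂ) * z = -1 by linear_combination h]; simp
  rw [norm_mul, RCLike.norm_conj] at h1
  nlinarith [a.norm_lt_one, norm_nonneg (a : ℂ), norm_nonneg z]

/-- The map `z ↦ (z + a) / (1 + ā z)`. -/
def mobius (a z : 𝔻) : 𝔻 := UnitDisc.mk (((z : ℂ) + a) / (1 + conj (a : ℂ) * z)) (norm_mobius_lt a z)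

theorem isHolo_mobius (a : 𝔻) : IsHolo (mobius a) := by
  refine ⟨fun z => (z + a) / (1 + conj (a : ℂ) * z), ?_, fun z => by simp [mobius]⟩
  refine DifferentiableOn.div (by fun_prop) (by fun_prop) ?_
  intro z hz
  exact mobius_den_ne a z (by simpa using hz)

theorem IsHolo.continuous {f : 𝔻 → 𝔻} (hf : IsHolo f) : Continuous f := by
  obtain ⟨F, hF, h⟩ := hf
  rw [UnitDisc.isEmbedding_coe.continuous_iff]
  have : ((↑) : 𝔻 → ℂ) ∘ f = F ∘ ((↑) : 𝔻 → ℂ) := funext h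
  rw [this]
  exact hF.continuousOn.comp_continuous UnitDisc.continuous_coe
    (fun z => by simpa using z.norm_lt_one)

theorem mobius_neg_mobius (a z : 𝔻) : mobius (-a) (mobius a z) = z := by
  apply UnitDisc.coe_injective
  have h1 := mobius_den_ne a z z.norm_lt_one
  have h2 := mobius_den_ne (-a) (mobius a z) (mobius a z).norm_lt_one
  have h3 := mobius_den_ne (-a) a a.norm_lt_one
  simp only [mobius, UnitDisc.coe_mk, UnitDisc.coe_neg, map_neg] at *
  rw [div_eq_iff h2]
  set D : ℂ := 1 + conj (a : ℂ) * z with hD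
  have hq : ((z : ℂ) + a) / D * D = z + a := div_mul_cancel₀ _ h1
  refine mul_right_cancel₀ h1 ?_
  linear_combination (1 + (z : ℂ) * conj (a : ℂ)) * hq + (-(a : ℂ) - z) * hD

/-- The automorphism group of the disc acts transitively. -/
theorem exists_discAut (a : 𝔻) : ∃ τ ∈ discAut, τ 0 = a := by
  refine ⟨⟨⟨mobius a, mobius (-a), mobius_neg_mobius a, fun z => ?_⟩,
    (isHolo_mobius a).continuous, (isHolo_mobius (-a)).continuous⟩,
    ⟨isHolo_mobius a, isHolo_mobius (-a)⟩, ?_⟩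
  · simpa using mobius_neg_mobius (-a) z
  · apply UnitDisc.coe_injective
    simp [mobius]

/-- The closed hyperbolic disc of radius `R` centred at `0`, for the Poincaré distance (of
curvature `-1`), which satisfies `d(0, ξ) = log ((1 + |ξ|) / (1 - |ξ|))`. -/
def closedHypDisc (R : ℝ) : Set 𝔻 := {ξ | Real.log ((1 + ‖(ξ : ℂ)‖) / (1 - ‖(ξ : ℂ)‖)) ≤ R}

/-! ### Suspensions -/

section Susp

variable {T : Type*} [MetricSpace T] (Γ : Subgroup (𝔻 ≃ₜ 𝔻)) (ρ : Γ →* (T ≃ₜ T))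

/-- The orbit relation of the diagonal action `γ · (z, t) = (γ z, ρ(γ) t)` on `𝔻 × T`. -/
def diagSetoid : Setoid (𝔻 × T) where
  r p q := ∃ γ : Γ, q = ((γ : 𝔻 ≃ₜ 𝔻) p.1, ρ γ p.2)
  iseqv :=
    { refl := fun p => ⟨1, by simp⟩
      symm := by
        rintro p q ⟨γ, rfl⟩
        refine ⟨γ⁻¹, ?_⟩
        ext1
        · exact ((γ : 𝔻 ≃ₜ 𝔻).symm_apply_apply p.1).symm
        · rw [map_inv]
          exact ((ρ γ).symm_apply_apply p.2).symm
      trans := by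
        rintro p q r ⟨γ, rfl⟩ ⟨δ, rfl⟩
        exact ⟨δ * γ, by rw [map_mul]; rfl⟩ }

/-- The space `X = (𝔻 × T)/Γ` carrying the suspension of `ρ`; its leaves are the images of the
discs `𝔻 × {t}`. -/
def Suspension : Type _ := Quotient (diagSetoid Γ ρ)

instance : TopologicalSpace (Suspension Γ ρ) :=
  inferInstanceAs (TopologicalSpace (Quotient (diagSetoid Γ ρ)))

/-- The class `[z, t]` of `(z, t)` in the suspension. -/
def cls (z : 𝔻) (t : T) : Suspension Γ ρ := Quotient.mk (diagSetoid Γ ρ) (z, t)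

/-- `φ` is a uniformization, centred at `x`, of the leaf through `x`. The leaf of `[z, t]` is
uniformized by the covering `z ↦ [z, t]`, and the other uniformizations of this leaf are obtained
from it by precomposition with an automorphism of the disc. -/
def IsUniformization (x : Suspension Γ ρ) (φ : 𝔻 → Suspension Γ ρ) : Prop :=
  (∃ τ ∈ discAut, ∃ t : T, ∀ ξ, φ ξ = cls Γ ρ (τ ξ) t) ∧ φ 0 = x

theorem exists_isUniformization (x : Suspension Γ ρ) : ∃ φ, IsUniformization Γ ρ x φ := by
  obtain ⟨⟨z, t⟩, rfl⟩ := Quotient.exists_rep x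
  obtain ⟨τ, hτ, h0⟩ := exists_discAut z
  exact ⟨fun ξ => cls Γ ρ (τ ξ) t, ⟨τ, hτ, t, fun _ => rfl⟩, by simp only [h0]; rfl⟩

/-- A uniformization `φ_x` of the leaf through `x` such that `φ_x(0) = x`. It is unique up to
precomposition by a rotation. -/
def leafUnif (x : Suspension Γ ρ) : 𝔻 → Suspension Γ ρ :=
  Classical.choose (exists_isUniformization Γ ρ x)

theorem leafUnif_spec (x : Suspension Γ ρ) : IsUniformization Γ ρ x (leafUnif Γ ρ x) :=
  Classical.choose_spec (exists_isUniformization Γ ρ x)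

/-- The base `V` of a flow box `[V × T]` of the suspension: a connected open subset of the disc
on which `𝔻 → 𝔻/Γ` is injective, so that `V × T → X`, `(z, t) ↦ [z, t]` is injective and its inverse
is a chart. -/
structure IsFlowBase (V : Set 𝔻) : Prop where
  isOpen : IsOpen V
  isConnected : IsConnected V
  disjoint : ∀ γ ∈ Γ, (γ '' V ∩ V).Nonempty → γ = 1

/-- The lamination is Lipschitz: `X` has an atlas of flow boxes `[V × T]` for which
every transition map `(z, t) ↦ (w, s)`, where `[z, t] = [w, s]`, is Lipschitz
on its domain of definition. -/
def IsLipschitzSuspension : Prop :=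
  ∃ A : Set (Set 𝔻), (∀ V ∈ A, IsFlowBase Γ V) ∧
    (∀ x : Suspension Γ ρ, ∃ V ∈ A, ∃ z ∈ V, ∃ t : T, cls Γ ρ z t = x) ∧
    ∀ V ∈ A, ∀ W ∈ A, ∃ K : ℝ≥0, ∀ z ∈ V, ∀ z' ∈ V, ∀ w ∈ W, ∀ w' ∈ W, ∀ t t' s s' : T,
      cls Γ ρ z t = cls Γ ρ w s → cls Γ ρ z' t' = cls Γ ρ w' s' →
        edist ((w : ℂ), s) ((w' : ℂ), s') ≤ K * edist ((z : ℂ), t) ((z' : ℂ), t')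

/-! ### Hyperbolic entropy -/

variable (d : Suspension Γ ρ → Suspension Γ ρ → ℝ≥0∞)

/-- The Bowen distance
`d_R(x, y) = inf_θ sup_ξ d(φ_x(ξ), φ_y(e^{iθ} ξ))`, with `ξ` in the closed hyperbolic disc of
radius `R`, for a distance `d` on the suspension. -/
def bowenDist (R : ℝ) (x y : Suspension Γ ρ) : ℝ≥0∞ :=
  ⨅ θ : ℝ, ⨆ ξ ∈ closedHypDisc R, d (leafUnif Γ ρ x ξ) (leafUnif Γ ρ y (Circle.exp θ • ξ))

/-- The minimal cardinality `N(Y, R, ε)` of a set of centres of `R`-Bowen balls of radius `ε`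
covering `Y`. -/
def coverNum (Y : Set (Suspension Γ ρ)) (R ε : ℝ) : ℕ∞ :=
  ⨅ (F : Finset (Suspension Γ ρ))
    (_ : ∀ y ∈ Y, ∃ x ∈ F, bowenDist Γ ρ d R x y < ENNReal.ofReal ε), (F.card : ℕ∞)

/-- The hyperbolic entropy
`h(Y) = sup_{ε > 0} limsup_{R → +∞} (1/R) log N(Y, R, ε)`. -/
def entropyOn (Y : Set (Suspension Γ ρ)) : EReal :=
  ⨆ (ε : ℝ) (_ : 0 < ε),
    limsup (fun R : ℝ => ENNReal.log (coverNum Γ ρ d Y R ε : ℝ≥0∞) / (R : EReal)) atTop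

/-- The hyperbolic entropy of the suspension lamination. -/
def hyperbolicEntropy : EReal := entropyOn Γ ρ d Set.univ

end Susp

end HypSusp

end

/-! ### Riemannian distance against chart distance. -/

section Riemannian

open Set MeasureTheory Metric Manifold

attribute [local instance] normedAddCommGroupTangentSpaceVectorSpace
attribute [local instance] normedSpaceTangentSpaceVectorSpace

variable {E : Type*} [NormedAddCommGroup E] [NormedSpace ℝ E]
  {H : Type*} [TopologicalSpace H] (I : ModelWithCorners ℝ E H)
  {M : Type*} [TopologicalSpace M] [ChartedSpace H M]
  [RiemannianBundle (fun (x : M) ↦ TangentSpace I x)]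
  [IsManifold I 1 M] [IsContinuousRiemannianBundle E (fun (x : M) ↦ TangentSpace I x)]

/-! A Bowen ball of radius `R` contains a product of a Euclidean ball of the disc and a ball of `T`
whose radii decrease only exponentially with `R`; so `X` needs at most exponentially many Bowen
balls once `T` has polynomial covering numbers.

Along the leaves, the Möbius translations with `0 ↦ a` and `0 ↦ b` differ at `ξ`, in
pseudo-hyperbolic distance, by at most a constant times `|a - b| (1 - |ξ|)⁻³`, and `(1 - |ξ|)⁻¹` is
at most `exp R` (`pseudoDist_mobius_mobius_le`). Across the leaves, the radius from `0` to `ξ` is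
cut into `O(R)` steps, each inside one of finitely many flow boxes, and each change of box costs a
fixed factor `L`; so the holonomy has Lipschitz constant `L ^ O(R)` (`lipschitzWith_holonomy`). Both
estimates combine in `exists_bowenDist_cls_lt`, whose rate `B` does not depend on `ε`.

`T` has polynomial covering numbers because its distance is dominated by that of `M`, itself
dominated in charts by the distance of a finite-dimensional space
(`hasPolynomialCover_univ_of_antilipschitzWith`). -/

/-- Around any point, the Riemannian distance of two points is bounded by a multiple of their
distance in the extended chart. -/
theorem exists_mem_nhds_riemannianEDist_le_edist_extChartAt (x : M) :
    ∃ C : ℝ≥0, ∃ U ∈ 𝓝 x, ∀ z ∈ U, ∀ y ∈ U,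
      riemannianEDist I z y ≤ C * edist (extChartAt I x z) (extChartAt I x y) := by
  rcases eventually_enorm_mfderivWithin_symm_extChartAt_lt I x with ⟨C, C_pos, hC₀⟩
  have hC : ∀ᶠ y in 𝓝[range I] (extChartAt I x x), ∀ v : E,
      ‖(mfderivWithin 𝓘(ℝ, E) I (extChartAt I x).symm (range I) y v :
        TangentSpace I ((extChartAt I x).symm y))‖ₑ ≤ C * ‖v‖ₑ := by
    filter_upwards [hC₀] with y hy v
    exact (ContinuousLinearMap.le_opENorm _ _).trans (mul_le_mul_left hy.le _)
  obtain ⟨r, r_pos, hr⟩ : ∃ r > 0,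
      ball (extChartAt I x x) r ∩ range I ⊆ (extChartAt I x).target ∩
        {y | ∀ v : E, ‖(mfderivWithin 𝓘(ℝ, E) I (extChartAt I x).symm (range I) y v :
          TangentSpace I ((extChartAt I x).symm y))‖ₑ ≤ C * ‖v‖ₑ} :=
    mem_nhdsWithin_iff.1 (inter_mem (extChartAt_target_mem_nhdsWithin x) hC)
  have A : (extChartAt I x) ⁻¹' (ball (extChartAt I x x) r ∩ range I) ∈ 𝓝 x := by
    apply extChartAt_preimage_mem_nhds_of_mem_nhdsWithin (by simp)
    rw [inter_comm]
    exact inter_mem_nhdsWithin _ (ball_mem_nhds _ r_pos)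
  refine ⟨C, _, inter_mem A (chart_source_mem_nhds H x), fun z hz y hy => ?_⟩
  -- The test path is the straight segment in the chart; it stays where the derivative of the
  -- inverse chart is at most `C`, since a ball of `E` and `range I` are both convex.
  let η := ContinuousAffineMap.lineMap (R := ℝ) (extChartAt I x z) (extChartAt I x y)
  set γ := (extChartAt I x).symm ∘ η
  have hη : Icc 0 1 ⊆ ⇑η ⁻¹' ((extChartAt I x).target ∩
        {y | ∀ v : E, ‖(mfderivWithin 𝓘(ℝ, E) I (extChartAt I x).symm (range I) y v :
          TangentSpace I ((extChartAt I x).symm y))‖ₑ ≤ C * ‖v‖ₑ}) := by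
    simp only [← image_subset_iff, ContinuousAffineMap.coe_lineMap_eq,
     ← segment_eq_image_lineMap, η]
    apply Subset.trans _ hr
    exact ((convex_ball _ _).inter I.convex_range).segment_subset hz.1 hy.1
  simp only [preimage_inter, subset_inter_iff] at hη
  have η_smooth : ContMDiffOn 𝓘(ℝ, ℝ) 𝓘(ℝ, E) 1 η (Icc 0 1) := by
    apply ContMDiff.contMDiffOn
    rw [contMDiff_iff_contDiff]
    exact ContinuousAffineMap.contDiff _
  have : riemannianEDist I z y ≤ pathELength I γ 0 1 := by
    apply riemannianEDist_le_pathELength _ _ _ zero_le_one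
    · exact (contMDiffOn_extChartAt_symm x).comp η_smooth hη.1
    · simp [γ, η, ContinuousAffineMap.coe_lineMap_eq, hz.2]
    · simp [γ, η, ContinuousAffineMap.coe_lineMap_eq, hy.2]
  apply this.trans
  rw [← lintegral_fderiv_lineMap_eq_edist, pathELength_eq_lintegral_mfderivWithin_Icc,
    ← lintegral_const_mul' _ _ ENNReal.coe_ne_top]
  apply setLIntegral_mono' measurableSet_Icc (fun t ht ↦ ?_)
  have : mfderivWithin 𝓘(ℝ, ℝ) I γ (Icc 0 1) t =
      (mfderivWithin 𝓘(ℝ, E) I (extChartAt I x).symm (range I) (η t)) ∘L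
        (mfderivWithin 𝓘(ℝ, ℝ) 𝓘(ℝ, E) η (Icc 0 1) t) := by
    apply mfderivWithin_comp
    · exact mdifferentiableWithinAt_extChartAt_symm (hη.1 ht)
    · exact η_smooth.mdifferentiableOn one_ne_zero t ht
    · exact hη.1.trans (preimage_mono (extChartAt_target_subset_range x))
    · rw [uniqueMDiffWithinAt_iff_uniqueDiffWithinAt]
      exact uniqueDiffOn_Icc zero_lt_one t ht
  have : mfderivWithin 𝓘(ℝ, ℝ) I γ (Icc 0 1) t 1 =
      (mfderivWithin 𝓘(ℝ, E) I (extChartAt I x).symm (range I) (η t))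
        (mfderivWithin 𝓘(ℝ, ℝ) 𝓘(ℝ, E) η (Icc 0 1) t 1) := congr($this 1)
  rw [this]
  refine (hη.2 ht _).trans_eq ?_
  rw [mfderivWithin_eq_fderivWithin]
  rfl

end Riemannian

/-! ### Polynomial covering numbers. -/

section Covering

/-- A set of points meeting all the values of `g` on `S`, of cardinality at most that of a finite
set containing these values. -/
theorem exists_finset_subset_forall_eq {α β : Type*} {S : Set α} {g : α → β} {G : Finset β}
    (hg : ∀ x ∈ S, g x ∈ G) :
    ∃ F : Finset α, (∀ x ∈ F, x ∈ S) ∧ F.card ≤ G.card ∧ ∀ x ∈ S, ∃ y ∈ F, g y = g x := by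
  classical
  obtain ⟨S', hS', hb⟩ := Set.exists_subset_bijOn S g
  have hfin : S'.Finite := by
    refine Set.Finite.of_finite_image (G.finite_toSet.subset ?_) hb.injOn
    rintro _ ⟨x, hx, rfl⟩
    exact hg x (hS' hx)
  refine ⟨hfin.toFinset, fun x hx => hS' (by simpa using hx), ?_, fun x hx => ?_⟩
  · refine Finset.card_le_card_of_injOn g (fun x hx => hg x (hS' (by simpa using hx))) ?_
    simpa using hb.injOn
  · obtain ⟨y, hy, h⟩ := hb.surjOn ⟨x, hx, rfl⟩
    exact ⟨y, by simpa using hy, h⟩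

/-- If `f` maps `S` to a bounded subset of `ℝⁿ` and `e` is dominated by the distance of the images,
then `S` is covered by at most `O(mⁿ)` sets of `e`-radius `1 / m`. -/
theorem exists_cover_of_edist_le_pi {α : Type*} {n : ℕ} {e : α → α → ℝ≥0∞} {S : Set α}
    {f : α → Fin n → ℝ} (hf : Bornology.IsBounded (f '' S)) {c : ℝ≥0}
    (hc : ∀ x ∈ S, ∀ y ∈ S, e x y ≤ c * edist (f x) (f y)) :
    ∃ A k : ℕ, ∀ m : ℕ, 1 ≤ m → ∃ F : Finset α, (∀ x ∈ F, x ∈ S) ∧ F.card ≤ A * m ^ k ∧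
      ∀ x ∈ S, ∃ y ∈ F, e y x ≤ (m : ℝ≥0∞)⁻¹ := by
  obtain ⟨B₀, hB₀⟩ := hf.subset_closedBall 0
  obtain ⟨B, hB⟩ := exists_nat_ge B₀
  obtain ⟨d, hd⟩ := exists_nat_ge (c + 1)
  have hd1 : 1 ≤ d := by
    have : (1 : ℝ≥0) ≤ d := le_trans (by simp) hd
    exact_mod_cast this
  -- The floors sort `S` into cubes of side `1 / N`, with `N = d * m` and `d ≥ c` absorbing the
  -- factor `c`. At most `(2BN + 1) ^ n` cubes meet the image, and `2BN + 1 ≤ (2B + 1)dm`.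
  refine ⟨((2 * B + 1) * d) ^ n, n, fun m hm => ?_⟩
  have hN : (0 : ℝ) < (d * m : ℕ) := by exact_mod_cast Nat.mul_pos hd1 hm
  set N : ℕ := d * m with hNdef
  have hbound : ∀ x ∈ S, ∀ i, |f x i| ≤ B := fun x hx i => by
    have := hB₀ ⟨x, hx, rfl⟩
    rw [mem_closedBall_zero_iff] at this
    exact ((norm_le_pi_norm (f x) i).trans this).trans hB
  obtain ⟨F, hFS, hcard, hF⟩ := exists_finset_subset_forall_eq (S := S)
    (g := fun x i => ⌊f x i * N⌋)
    (G := Fintype.piFinset fun _ : Fin n => Finset.Icc (-(B * N : ℤ)) (B * N)) (by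
      intro x hx
      rw [Fintype.mem_piFinset]
      intro i
      obtain ⟨h1, h2⟩ := abs_le.1 (hbound x hx i)
      rw [Finset.mem_Icc]
      constructor
      · rw [Int.le_floor]
        push_cast
        nlinarith
      · have : (⌊f x i * N⌋ : ℝ) ≤ ((B * N : ℤ) : ℝ) := by
          refine (Int.floor_le _).trans ?_
          push_cast
          gcongr
        exact_mod_cast this)
  refine ⟨F, hFS, hcard.trans ?_, fun x hx => ?_⟩
  · rw [Fintype.card_piFinset_const, Int.card_Icc, ← mul_pow]
    refine Nat.pow_le_pow_left ?_ n
    have hN1 : 1 ≤ N := by exact_mod_cast hN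
    have : ((B * N + 1 - -(B * N) : ℤ)).toNat = 2 * B * N + 1 := by
      have : (B * N + 1 - -(B * N) : ℤ) = ((2 * B * N + 1 : ℕ) : ℤ) := by push_cast; ring
      rw [this, Int.toNat_natCast]
    rw [this, mul_assoc (2 * B + 1) d m, ← hNdef]
    nlinarith
  · obtain ⟨y, hy, h⟩ := hF x hx
    refine ⟨y, hy, (hc y (hFS y hy) x hx).trans ?_⟩
    have hdist : edist (f y) (f x) ≤ (N : ℝ≥0∞)⁻¹ := by
      have h1 : dist (f y) (f x) ≤ (N : ℝ)⁻¹ := by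
        rw [dist_pi_le_iff (by positivity)]
        intro i
        have := Int.abs_sub_lt_one_of_floor_eq_floor (congrFun h i)
        rw [← sub_mul, abs_mul, abs_of_pos hN] at this
        rw [Real.dist_eq, inv_eq_one_div, le_div_iff₀ hN]
        exact this.le
      rw [edist_dist]
      refine (ENNReal.ofReal_le_ofReal h1).trans_eq ?_
      rw [ENNReal.ofReal_inv_of_pos hN, ENNReal.ofReal_natCast]
    refine (mul_le_mul_right hdist _).trans ?_
    have hcd : (c : ℝ≥0∞) ≤ d := by
      exact_mod_cast (le_add_of_nonneg_right zero_le_one).trans hd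
    refine (mul_le_mul_left hcd _).trans_eq ?_
    rw [hNdef, Nat.cast_mul, ENNReal.mul_inv (by simp) (by simp), ← mul_assoc,
      ENNReal.mul_inv_cancel (by exact_mod_cast (Nat.pos_of_ne_zero (by omega)).ne') (by simp),
      one_mul]

/-- If `f` maps `S` to a bounded subset of a finite-dimensional space and `e` is dominated by the
distance of the images, then `S` is covered by polynomially many sets of `e`-radius `1 / m`. -/
theorem exists_cover_of_edist_le {α E : Type*} [NormedAddCommGroup E] [NormedSpace ℝ E]
    [FiniteDimensional ℝ E] {e : α → α → ℝ≥0∞} {S : Set α}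
    {f : α → E} (hf : Bornology.IsBounded (f '' S)) {c : ℝ≥0}
    (hc : ∀ x ∈ S, ∀ y ∈ S, e x y ≤ c * edist (f x) (f y)) :
    ∃ A k : ℕ, ∀ m : ℕ, 1 ≤ m → ∃ F : Finset α, (∀ x ∈ F, x ∈ S) ∧ F.card ≤ A * m ^ k ∧
      ∀ x ∈ S, ∃ y ∈ F, e y x ≤ (m : ℝ≥0∞)⁻¹ := by
  set L := (Module.finBasis ℝ E).equivFunL
  refine exists_cover_of_edist_le_pi (f := fun x => L (f x))
    (c := c * ‖(L.symm : (Fin (Module.finrank ℝ E) → ℝ) →L[ℝ] E)‖₊) ?_ fun x hx y hy => (hc x hx y hy).trans ?_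
  · have := L.lipschitz.isBounded_image hf
    rwa [Set.image_image] at this
  · rw [ENNReal.coe_mul, mul_assoc]
    gcongr
    exact L.antilipschitz (f x) (f y)

/-- A set is covered by polynomially many sets of `e`-radius `1 / m`. -/
def HasPolynomialCover {α : Type*} (e : α → α → ℝ≥0∞) (S : Set α) : Prop :=
  ∃ A k : ℕ, ∀ m : ℕ, 1 ≤ m → ∃ F : Finset α, F.card ≤ A * m ^ k ∧
    ∀ x ∈ S, ∃ y ∈ F, e y x ≤ (m : ℝ≥0∞)⁻¹

theorem HasPolynomialCover.union {α : Type*} {e : α → α → ℝ≥0∞} {S S' : Set α}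
    (h : HasPolynomialCover e S) (h' : HasPolynomialCover e S') :
    HasPolynomialCover e (S ∪ S') := by
  classical
  obtain ⟨A, k, h⟩ := h
  obtain ⟨A', k', h'⟩ := h'
  refine ⟨A + A', max k k', fun m hm => ?_⟩
  obtain ⟨F, hc, hF⟩ := h m hm
  obtain ⟨F', hc', hF'⟩ := h' m hm
  refine ⟨F ∪ F', (Finset.card_union_le _ _).trans ?_, ?_⟩
  · rw [add_mul]
    refine add_le_add (hc.trans ?_) (hc'.trans ?_) <;> gcongr <;> simp
  · rintro x (hx | hx)
    · obtain ⟨y, hy, h⟩ := hF x hx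
      exact ⟨y, Finset.mem_union_left _ hy, h⟩
    · obtain ⟨y, hy, h⟩ := hF' x hx
      exact ⟨y, Finset.mem_union_right _ hy, h⟩

/-- A compact space which embeds, with an antilipschitz map, in a finite-dimensional Riemannian
manifold has polynomial covering numbers. -/
theorem hasPolynomialCover_univ_of_antilipschitzWith {T : Type*} [PseudoEMetricSpace T]
    [CompactSpace T] {E : Type*} [NormedAddCommGroup E] [NormedSpace ℝ E] [FiniteDimensional ℝ E]
    {H : Type*} [TopologicalSpace H] (I : ModelWithCorners ℝ E H)
    {M : Type*} [EMetricSpace M] [ChartedSpace H M]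
    [RiemannianBundle (fun x : M => TangentSpace I x)]
    [IsManifold I 1 M] [IsContinuousRiemannianBundle E (fun x : M => TangentSpace I x)]
    [IsRiemannianManifold I M] {j : T → M} (hj : Continuous j) {C : ℝ≥0}
    (hC : AntilipschitzWith C j) :
    HasPolynomialCover (fun s t : T => edist s t) Set.univ := by
  -- Polynomial covering passes to subsets and finite unions, so by compactness it need only be
  -- checked near each point.
  refine isCompact_univ.induction_on (p := HasPolynomialCover fun s t : T => edist s t)
    ⟨0, 0, fun m _ => ⟨∅, by simp⟩⟩ ?_ (fun S S' => HasPolynomialCover.union) fun t _ => ?_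
  · rintro S S' hS ⟨A, k, h⟩
    refine ⟨A, k, fun m hm => ?_⟩
    obtain ⟨F, hc, hF⟩ := h m hm
    exact ⟨F, hc, fun x hx => hF x (hS hx)⟩
  · obtain ⟨D, U, hU, hD⟩ := exists_mem_nhds_riemannianEDist_le_edist_extChartAt I (j t)
    have hV : (extChartAt I (j t)) ⁻¹' Metric.ball (extChartAt I (j t) (j t)) 1 ∈ 𝓝 (j t) :=
      (continuousAt_extChartAt (j t)).preimage_mem_nhds (Metric.ball_mem_nhds _ one_pos)
    refine ⟨j ⁻¹' (U ∩ (extChartAt I (j t)) ⁻¹' Metric.ball (extChartAt I (j t) (j t)) 1),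
      mem_nhdsWithin_of_mem_nhds (hj.continuousAt.preimage_mem_nhds (inter_mem hU hV)), ?_⟩
    have hb : Bornology.IsBounded ((fun s => extChartAt I (j t) (j s)) '' (j ⁻¹'
        (U ∩ (extChartAt I (j t)) ⁻¹' Metric.ball (extChartAt I (j t) (j t)) 1))) := by
      refine (Metric.isBounded_ball (x := extChartAt I (j t) (j t)) (r := 1)).subset ?_
      rintro _ ⟨s, hs, rfl⟩
      exact hs.2
    obtain ⟨A, k, h⟩ := exists_cover_of_edist_le (e := fun s t : T => edist s t) hb (c := C * D)
      (fun x hx y hy => by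
        refine (hC x y).trans ?_
        rw [ENNReal.coe_mul, mul_assoc, IsRiemannianManifold.out (I := I) (j x) (j y)]
        gcongr
        exact hD _ hx.1 _ hy.1)
    refine ⟨A, k, fun m hm => ?_⟩
    obtain ⟨F, -, hF⟩ := h m hm
    exact ⟨F, hF⟩

end Covering

noncomputable section

namespace HypSusp

/-! ### Pseudo-hyperbolic distance -/

theorem mobius_mobius_neg (a z : 𝔻) : mobius a (mobius (-a) z) = z := by
  simpa using mobius_neg_mobius (-a) z

theorem mobius_zero_right (a : 𝔻) : mobius a 0 = a := by
  apply UnitDisc.coe_injective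
  simp [mobius]

theorem mobius_neg_self (a : 𝔻) : mobius (-a) a = 0 := by
  apply UnitDisc.coe_injective
  simp [mobius]

/-- The pseudo-hyperbolic distance of the disc. -/
def pseudoDist (z w : 𝔻) : ℝ := ‖(mobius (-w) z : ℂ)‖

theorem pseudoDist_eq (z w : 𝔻) :
    pseudoDist z w = ‖(z : ℂ) - w‖ / ‖1 - conj (w : ℂ) * z‖ := by
  simp [pseudoDist, mobius, sub_eq_add_neg]

theorem IsHolo.norm_le_norm {f : 𝔻 → 𝔻} (hf : IsHolo f) (h0 : f 0 = 0) (z : 𝔻) :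
    ‖(f z : ℂ)‖ ≤ ‖(z : ℂ)‖ := by
  obtain ⟨F, hF, h⟩ := hf
  rw [h]
  refine norm_le_norm_of_mapsTo_ball hF (fun w hw => ?_) (by simpa [h0] using (h 0).symm)
    z.norm_lt_one
  have := (f (UnitDisc.mk w (by simpa using hw))).norm_lt_one
  rw [h] at this
  simpa using this.le

/-- The Schwarz–Pick lemma. -/
theorem IsHolo.pseudoDist_le {f : 𝔻 → 𝔻} (hf : IsHolo f) (z w : 𝔻) :
    pseudoDist (f z) (f w) ≤ pseudoDist z w := by
  have h := ((isHolo_mobius (-f w)).comp (hf.comp (isHolo_mobius w))).norm_le_norm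
    (by simp only [mobius_zero_right, mobius_neg_self]) (mobius (-w) z)
  simp only [mobius_mobius_neg] at h
  exact h

/-- The denominator of `pseudoDist` is at most `2`. This converts the automorphism-invariant
estimates into Euclidean ones. -/
theorem norm_sub_le_two_mul_pseudoDist (z w : 𝔻) : ‖(z : ℂ) - w‖ ≤ 2 * pseudoDist z w := by
  have h2 : ‖1 - conj (w : ℂ) * z‖ ≤ 2 := by
    refine (norm_sub_le _ _).trans ?_
    rw [norm_one, norm_mul, RCLike.norm_conj]
    nlinarith [z.norm_lt_one, w.norm_lt_one, norm_nonneg (w : ℂ), norm_nonneg (z : ℂ)]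
  have h0 : 0 < ‖1 - conj (w : ℂ) * z‖ := by
    rw [norm_pos_iff]
    simpa [sub_eq_add_neg] using mobius_den_ne (-w) z z.norm_lt_one
  rw [pseudoDist_eq, ← mul_div_assoc, le_div_iff₀ h0]
  nlinarith [norm_nonneg ((z : ℂ) - w)]

theorem one_sub_norm_le_norm_one_add_conj_mul (a z : 𝔻) :
    1 - ‖(z : ℂ)‖ ≤ ‖1 + conj (a : ℂ) * z‖ := by
  have h := norm_sub_le_norm_add (1 : ℂ) (conj (a : ℂ) * z)
  rw [norm_one, norm_mul, RCLike.norm_conj] at h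
  nlinarith [a.norm_lt_one, norm_nonneg (z : ℂ)]

/-- Write `x` for the modulus of the image and `D` for that of the denominator: `D² (1 - x²) = (1 -
|a|²)(1 - |z|²)`. The `8` comes from `D² ≤ 4` and `1 - x² ≤ 2(1 - x)`. -/
theorem le_one_sub_norm_mobius (a z : 𝔻) :
    (1 - ‖(a : ℂ)‖) * (1 - ‖(z : ℂ)‖) / 8 ≤ 1 - ‖(mobius a z : ℂ)‖ := by
  have key : ‖1 + conj (a : ℂ) * z‖ ^ 2 - ‖(z : ℂ) + a‖ ^ 2
      = (1 - ‖(a : ℂ)‖ ^ 2) * (1 - ‖(z : ℂ)‖ ^ 2) := by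
    simp only [← normSq_eq_norm_sq, normSq_apply, add_re, add_im, mul_re, mul_im, conj_re,
      conj_im, one_re, one_im]
    ring
  have hD2 : ‖1 + conj (a : ℂ) * z‖ ≤ 2 := by
    refine (norm_add_le _ _).trans ?_
    rw [norm_one, norm_mul, RCLike.norm_conj]
    nlinarith [z.norm_lt_one, a.norm_lt_one, norm_nonneg (a : ℂ), norm_nonneg (z : ℂ)]
  have hD0 : 0 < ‖1 + conj (a : ℂ) * z‖ := norm_pos_iff.2 (mobius_den_ne a z z.norm_lt_one)
  have hm : ‖(mobius a z : ℂ)‖ * ‖1 + conj (a : ℂ) * z‖ = ‖(z : ℂ) + a‖ := by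
    rw [mobius, UnitDisc.coe_mk, norm_div, div_mul_cancel₀ _ hD0.ne']
  rw [← hm, mul_pow] at key
  have ha := a.norm_lt_one
  have hz := z.norm_lt_one
  have hx := (mobius a z).norm_lt_one
  generalize ‖(mobius a z : ℂ)‖ = x at *
  generalize ‖1 + conj (a : ℂ) * z‖ = D at *
  have ha0 := norm_nonneg (a : ℂ)
  have hz0 := norm_nonneg (z : ℂ)
  generalize ‖(a : ℂ)‖ = p at *
  generalize ‖(z : ℂ)‖ = r at *
  have h1 : (1 - p) * (1 - r) ≤ (1 - p ^ 2) * (1 - r ^ 2) := by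
    apply mul_le_mul <;> nlinarith
  have hx0 : 0 ≤ x := by
    have := norm_nonneg ((z : ℂ) + a)
    rw [← hm] at this
    exact nonneg_of_mul_nonneg_left this hD0
  have h2 : (1 - p ^ 2) * (1 - r ^ 2) ≤ 8 * (1 - x) := by
    have h3 : D ^ 2 ≤ 4 := by nlinarith
    have h4 : 1 - x ^ 2 ≤ 2 * (1 - x) := by nlinarith
    have h5 : 0 ≤ 1 - x ^ 2 := by nlinarith
    nlinarith
  linarith

/-- The orbit maps of two translations with close values at the origin are close, with an error
depending exponentially on the hyperbolic distance to the origin. -/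
theorem pseudoDist_mobius_mobius_le (a b z : 𝔻) :
    pseudoDist (mobius b z) (mobius a z) ≤
      32 * ‖(a : ℂ) - b‖ / ((1 - ‖(a : ℂ)‖) * (1 - ‖(z : ℂ)‖) ^ 3) := by
  have hz : 0 < 1 - ‖(z : ℂ)‖ := sub_pos.2 z.norm_lt_one
  have ha : 0 < 1 - ‖(a : ℂ)‖ := sub_pos.2 a.norm_lt_one
  have hA := mobius_den_ne a z z.norm_lt_one
  have hB := mobius_den_ne b z z.norm_lt_one
  have hdiff : (mobius b z : ℂ) - mobius a z = ((b - a) + (conj (a : ℂ) - conj (b : ℂ)) * z ^ 2 +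
      ((b - a) * conj (a : ℂ) + a * (conj (a : ℂ) - conj (b : ℂ))) * z) /
        ((1 + conj (b : ℂ) * z) * (1 + conj (a : ℂ) * z)) := by
    simp only [mobius, UnitDisc.coe_mk]
    rw [div_sub_div _ _ hB hA]
    congr 1
    ring
  have hnum : ‖((b : ℂ) - a) + (conj (a : ℂ) - conj (b : ℂ)) * z ^ 2 +
      ((b - a) * conj (a : ℂ) + a * (conj (a : ℂ) - conj (b : ℂ))) * z‖ ≤ 4 * ‖(a : ℂ) - b‖ := by
    have hba : ‖(b : ℂ) - a‖ = ‖(a : ℂ) - b‖ := norm_sub_rev _ _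
    have hc : ‖conj (a : ℂ) - conj (b : ℂ)‖ = ‖(a : ℂ) - b‖ := by
      rw [← map_sub, RCLike.norm_conj]
    have hn := norm_nonneg ((a : ℂ) - b)
    have hz0 := norm_nonneg (z : ℂ)
    have ha0 := norm_nonneg (a : ℂ)
    refine (norm_add_le _ _).trans ?_
    have h1 : ‖((b : ℂ) - a) + (conj (a : ℂ) - conj (b : ℂ)) * z ^ 2‖ ≤ 2 * ‖(a : ℂ) - b‖ := by
      refine (norm_add_le _ _).trans ?_
      rw [norm_mul, hba, hc, norm_pow]
      nlinarith [mul_le_mul_of_nonneg_left (pow_le_one₀ (n := 2) hz0 z.norm_lt_one.le) hn]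
    have h2 : ‖((b : ℂ) - a) * conj (a : ℂ) + a * (conj (a : ℂ) - conj (b : ℂ))‖
        ≤ 2 * ‖(a : ℂ) - b‖ := by
      refine (norm_add_le _ _).trans ?_
      rw [norm_mul, norm_mul, hba, hc, RCLike.norm_conj]
      nlinarith [mul_le_mul_of_nonneg_left a.norm_lt_one.le hn]
    rw [norm_mul]
    nlinarith [mul_le_mul h2 z.norm_lt_one.le hz0 (by positivity)]
  have hsub : ‖(mobius b z : ℂ) - mobius a z‖ ≤ 4 * ‖(a : ℂ) - b‖ / (1 - ‖(z : ℂ)‖) ^ 2 := by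
    rw [hdiff, norm_div, norm_mul, sq (1 - ‖(z : ℂ)‖)]
    exact div_le_div₀ (by positivity) hnum (by positivity)
      (mul_le_mul (one_sub_norm_le_norm_one_add_conj_mul b z)
        (one_sub_norm_le_norm_one_add_conj_mul a z) hz.le (norm_nonneg _))
  -- Only the image under `mobius a` is kept away from the circle, so the final bound involves `1 -
  -- |a|` and nothing about `b`. The constant is `32 = 4 * 8`.
  have hden : (1 - ‖(a : ℂ)‖) * (1 - ‖(z : ℂ)‖) / 8 ≤
      ‖1 - conj (mobius a z : ℂ) * (mobius b z : ℂ)‖ := by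
    refine (le_one_sub_norm_mobius a z).trans ?_
    have h := norm_sub_norm_le (1 : ℂ) (conj (mobius a z : ℂ) * (mobius b z : ℂ))
    rw [norm_one, norm_mul, RCLike.norm_conj] at h
    nlinarith [(mobius b z).norm_lt_one, norm_nonneg (mobius a z : ℂ)]
  rw [pseudoDist_eq]
  calc _ ≤ (4 * ‖(a : ℂ) - b‖ / (1 - ‖(z : ℂ)‖) ^ 2) / ((1 - ‖(a : ℂ)‖) * (1 - ‖(z : ℂ)‖) / 8) := by
        gcongr
    _ = _ := by
        field_simp
        ring

/-- An automorphism of the disc is determined up to rotation by its value at the origin. -/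
theorem exists_circle_eq_mobius {τ : 𝔻 ≃ₜ 𝔻} (hτ : τ ∈ discAut) :
    ∃ c : Circle, ∀ z, τ z = mobius (τ 0) (c • z) := by
  set g : 𝔻 → 𝔻 := fun z => mobius (-τ 0) (τ z) with hg
  have hgH : IsHolo g := (isHolo_mobius _).comp hτ.1
  have hg0 : g 0 = 0 := mobius_neg_self _
  have hnorm : ∀ z, ‖(g z : ℂ)‖ = ‖(z : ℂ)‖ := by
    intro z
    refine le_antisymm (hgH.norm_le_norm hg0 z) ?_
    have h := (hτ.2.comp (isHolo_mobius (τ 0))).norm_le_norm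
      (by simp only [mobius_zero_right, Homeomorph.symm_apply_apply]) (g z)
    simpa only [hg, mobius_mobius_neg, Homeomorph.symm_apply_apply] using h
  obtain ⟨F, hF, h⟩ := hgH
  have hF0 : F 0 = 0 := by simpa [hg0] using (h 0).symm
  have hmem : ∀ w ∈ Metric.ball (0 : ℂ) 1, ‖F w‖ = ‖w‖ := by
    intro w hw
    have := hnorm (UnitDisc.mk w (by simpa using hw))
    rwa [h, UnitDisc.coe_mk] at this
  -- Equality case of the Schwarz lemma: the slope at `1 / 2` has modulus `1`, so `F` is linear.
  obtain ⟨C, hC, hFC⟩ := affine_of_mapsTo_ball_of_exists_norm_dslope_eq_div' (R₂ := 1) hF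
    (fun w hw => by
      rw [hF0, mem_closedBall_zero_iff, hmem w hw]
      exact (mem_ball_zero_iff.1 hw).le)
    ⟨1 / 2, by simp; norm_num, by
      rw [dslope_of_ne _ (by norm_num), slope_def_field, hF0, sub_zero, sub_zero, norm_div,
        hmem _ (by simp; norm_num)]
      norm_num⟩
  let c : Circle := ⟨C, by simpa [Submonoid.unitSphere] using hC⟩
  refine ⟨c, fun z => ?_⟩
  have hz : g z = c • z := by
    apply UnitDisc.coe_injective
    rw [h, UnitDisc.coe_circle_smul, hFC (by simpa using z.norm_lt_one), hF0]
    simp [c, mul_comm]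
  rw [← hz, hg]
  exact (mobius_mobius_neg _ _).symm

/-- One step of size `η` along the radius of a point, towards the origin. -/
theorem exists_pseudoDist_le_radial {η : ℝ} (h0 : 0 < η) (h1 : η < 1) (n : ℕ) (ξ : 𝔻)
    (h : (1 + ‖(ξ : ℂ)‖) / (1 - ‖(ξ : ℂ)‖) ≤ ((1 + η) / (1 - η)) ^ (n + 1)) :
    ∃ ξ' : 𝔻, pseudoDist ξ ξ' ≤ η ∧
      (1 + ‖(ξ' : ℂ)‖) / (1 - ‖(ξ' : ℂ)‖) ≤ ((1 + η) / (1 - η)) ^ n := by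
  have hq : 1 ≤ (1 + η) / (1 - η) := by
    rw [le_div_iff₀ (by linarith)]; linarith
  rcases le_total ‖(ξ : ℂ)‖ η with hr | hr
  · refine ⟨0, by simpa [pseudoDist_eq] using hr, by simpa using one_le_pow₀ hq⟩
  set r := ‖(ξ : ℂ)‖ with hrdef
  have hr1 : r < 1 := ξ.norm_lt_one
  have hr0 : 0 < r := h0.trans_le hr
  have hden : 0 < 1 - η * r := by nlinarith
  -- This is the radius reached from `r` by moving a pseudo-hyperbolic distance `η` towards `0`; it
  -- divides `(1 + r) / (1 - r)`, the exponential of the hyperbolic distance to `0`, by exactly `(1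
  -- + η) / (1 - η)`.
  set s := (r - η) / (1 - η * r) with hs
  have hs0 : 0 ≤ s := div_nonneg (by linarith) hden.le
  have hs1 : s < 1 := by rw [hs, div_lt_one hden]; nlinarith
  have hn : ‖((s / r : ℝ) : ℂ) * ξ‖ = s := by
    rw [norm_mul, norm_real, ← hrdef, Real.norm_of_nonneg (by positivity),
      div_mul_cancel₀ _ hr0.ne']
  refine ⟨UnitDisc.mk (((s / r : ℝ) : ℂ) * ξ) (hn.trans_lt hs1), ?_, ?_⟩
  · have hsq : conj (ξ : ℂ) * ξ = ((r ^ 2 : ℝ) : ℂ) := by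
      rw [conj_mul', ← hrdef]; push_cast; rfl
    have e1 : (ξ : ℂ) - ((s / r : ℝ) : ℂ) * ξ = ((1 - s / r : ℝ) : ℂ) * ξ := by push_cast; ring
    have e2 : 1 - conj (((s / r : ℝ) : ℂ) * ξ) * ξ = ((1 - s * r : ℝ) : ℂ) := by
      rw [map_mul, conj_ofReal, mul_assoc, hsq, ← ofReal_mul, ← ofReal_one, ← ofReal_sub]
      congr 1
      field_simp
    rw [pseudoDist_eq, UnitDisc.coe_mk, e1, e2, norm_mul, norm_real, norm_real, ← hrdef]
    have hsr : 0 < 1 - s * r := by nlinarith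
    have hsr' : s ≤ r := by
      rw [hs, div_le_iff₀ hden]
      nlinarith [mul_nonneg h0.le (mul_nonneg (sub_nonneg.2 hr1.le) (by linarith : 0 ≤ 1 + r))]
    rw [Real.norm_of_nonneg hsr.le,
      Real.norm_of_nonneg (sub_nonneg.2 ((div_le_one hr0).2 hsr')), div_le_iff₀ hsr]
    have : (1 - s / r) * r = r - s := by field_simp
    rw [this]
    have hs' : s * (1 - η * r) = r - η := div_mul_cancel₀ _ hden.ne'
    nlinarith
  · rw [UnitDisc.coe_mk, hn]
    have hs' : (1 + s) / (1 - s) = ((1 + r) / (1 - r)) / ((1 + η) / (1 - η)) := by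
      have a1 : 1 + s = (1 - η) * (1 + r) / (1 - η * r) := by
        rw [hs, eq_div_iff hden.ne', add_mul, div_mul_cancel₀ _ hden.ne']; ring
      have a2 : 1 - s = (1 + η) * (1 - r) / (1 - η * r) := by
        rw [hs, eq_div_iff hden.ne', sub_mul, div_mul_cancel₀ _ hden.ne']; ring
      have b1 : 1 - r ≠ 0 := by linarith
      have b2 : 1 - η ≠ 0 := by linarith
      rw [a1, a2]
      field_simp
    rw [hs', div_le_iff₀ (by positivity), ← pow_succ]
    exact h

end HypSusp

end

noncomputable section

namespace HypSusp

/-! ### Lipschitz constants of the holonomy -/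

section Holonomy

variable {T : Type*} [MetricSpace T] {Γ : Subgroup (𝔻 ≃ₜ 𝔻)} {ρ : Γ →* (T ≃ₜ T)}

theorem cls_apply_apply (γ : Γ) (z : 𝔻) (t : T) :
    cls Γ ρ ((γ : 𝔻 ≃ₜ 𝔻) z) (ρ γ t) = cls Γ ρ z t :=
  (Quotient.sound (s := diagSetoid Γ ρ) (a := (z, t)) (b := ((γ : 𝔻 ≃ₜ 𝔻) z, ρ γ t))
    ⟨γ, rfl⟩).symm

theorem exists_of_cls_eq {z w : 𝔻} {t s : T} (h : cls Γ ρ z t = cls Γ ρ w s) :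
    ∃ γ : Γ, w = (γ : 𝔻 ≃ₜ 𝔻) z ∧ s = ρ γ t := by
  obtain ⟨γ, h⟩ := Quotient.exact h
  exact ⟨γ, congrArg Prod.fst h, congrArg Prod.snd h⟩

theorem continuous_cls : Continuous fun p : 𝔻 × T => cls Γ ρ p.1 p.2 :=
  continuous_quotient_mk'

/-- The flow boxes of a Lipschitz suspension over a compact surface can be taken in finite number,
with a Lebesgue number for the pseudo-hyperbolic distance. -/
theorem exists_finset_flowBase [Nonempty T] (hΓ : IsSurfaceGroup Γ)
    (hLip : IsLipschitzSuspension Γ ρ) :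
    ∃ (F : Finset (Set 𝔻)) (L : ℕ) (K : Set 𝔻) (η : ℝ), 1 ≤ L ∧ IsCompact K ∧ 0 < η ∧ η < 1 ∧
      (∀ z : 𝔻, ∃ g : Γ, (g : 𝔻 ≃ₜ 𝔻) z ∈ K ∧ ∃ V ∈ F,
        ∀ w, pseudoDist w z ≤ η → (g : 𝔻 ≃ₜ 𝔻) w ∈ V) ∧
      ∀ V ∈ F, ∀ W ∈ F, ∀ g : Γ, ∀ z ∈ V, (g : 𝔻 ≃ₜ 𝔻) z ∈ W → LipschitzWith L (ρ g) := by
  classical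
  let _ : MetricSpace 𝔻 := UnitDisc.isEmbedding_coe.comapMetricSpace _
  obtain ⟨A, hA, hcov, hK⟩ := hLip
  obtain ⟨K, hKc, hKΓ⟩ := hΓ.cocompact
  let U : Γ × A → Set 𝔻 := fun p => (p.1 : 𝔻 ≃ₜ 𝔻) ⁻¹' p.2
  have hUo : ∀ p, IsOpen (U p) := fun p =>
    (hA p.2 p.2.2).isOpen.preimage (p.1 : 𝔻 ≃ₜ 𝔻).continuous
  have hKU : K ⊆ ⋃ p, U p := by
    intro z _
    obtain ⟨V, hV, w, hw, s, h⟩ := hcov (cls Γ ρ z (Classical.arbitrary T))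
    obtain ⟨γ, rfl, -⟩ := exists_of_cls_eq h.symm
    exact Set.mem_iUnion.2 ⟨(γ, ⟨V, hV⟩), hw⟩
  obtain ⟨s, hs⟩ := hKc.elim_finite_subcover U hUo hKU
  obtain ⟨δ, hδ, hball⟩ := lebesgue_number_lemma_of_metric (c := fun p : s => U p) hKc
    (fun p => hUo p) (fun z hz => by
      obtain ⟨p, hp, hz⟩ := Set.mem_iUnion₂.1 (hs hz)
      exact Set.mem_iUnion.2 ⟨⟨p, hp⟩, hz⟩)
  choose! c hc using hK
  let F : Finset (Set 𝔻) := s.image fun p => (p.2 : Set 𝔻)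
  have hFA : ∀ V ∈ F, V ∈ A := by
    intro V hV
    obtain ⟨p, -, rfl⟩ := Finset.mem_image.1 hV
    exact p.2.2
  obtain ⟨L, hL⟩ := exists_nat_ge (((F ×ˢ F).sup fun p => c p.1 p.2) + 1)
  -- The element bringing `z` into a box is `p.1 * γ`, hence the enlarged compact set. Euclidean
  -- distance is at most twice `pseudoDist`, so `η ≤ δ / 4` keeps the points within `δ`.
  refine ⟨F, L, ⋃ p ∈ s, (p.1 : 𝔻 ≃ₜ 𝔻) '' K, min (1 / 2) (δ / 4), ?_,
    s.isCompact_biUnion fun p _ => hKc.image (p.1 : 𝔻 ≃ₜ 𝔻).continuous, by positivity,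
    (min_le_left _ _).trans_lt (by norm_num), fun z => ?_, fun V hV W hW g z hz hgz => ?_⟩
  · have : (1 : ℝ≥0) ≤ L := le_trans (by simp) hL
    exact_mod_cast this
  · obtain ⟨γ, hγ, hz⟩ := hKΓ z
    obtain ⟨p, hp⟩ := hball _ hz
    refine ⟨(p : Γ × A).1 * ⟨γ, hγ⟩, Set.mem_biUnion p.2 ⟨γ z, hz, rfl⟩, (p : Γ × A).2,
      Finset.mem_image_of_mem _ p.2, fun w hw => hp (?_ : γ w ∈ Metric.ball (γ z) δ)⟩
    have h1 : dist (γ w) (γ z) = ‖(γ w : ℂ) - γ z‖ := dist_eq_norm (γ w : ℂ) (γ z)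
    rw [Metric.mem_ball, h1]
    have h2 := (hΓ.le_discAut hγ).1.pseudoDist_le w z
    linarith [norm_sub_le_two_mul_pseudoDist (γ w) (γ z), min_le_right (1 / 2 : ℝ) (δ / 4)]
  · have hcL : c V W ≤ L := by
      refine le_trans ?_ hL
      have := Finset.le_sup (f := fun p : Set 𝔻 × Set 𝔻 => c p.1 p.2)
        (Finset.mk_mem_product hV hW)
      exact this.trans (by simp)
    refine LipschitzWith.weaken (K := c V W) (fun t t' => ?_) hcL
    -- With both disc coordinates fixed, the transition bound reduces to one on `T`, and its
    -- constant depends on the boxes alone, not on `g`.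
    have := hc V (hFA V hV) W (hFA W hW) z hz z hz _ hgz _ hgz t t' (ρ g t) (ρ g t')
      (cls_apply_apply g z t).symm (cls_apply_apply g z t').symm
    simpa [Prod.edist_eq] using this

/-- The holonomy along a geodesic of the disc is Lipschitz, with a constant depending exponentially
on the length. -/
theorem lipschitzWith_holonomy {F : Finset (Set 𝔻)} {L : ℕ} {η : ℝ} (h0 : 0 < η) (h1 : η < 1)
    (hcov : ∀ z : 𝔻, ∃ g : Γ, ∃ V ∈ F, ∀ w, pseudoDist w z ≤ η → (g : 𝔻 ≃ₜ 𝔻) w ∈ V)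
    (hL : ∀ V ∈ F, ∀ W ∈ F, ∀ g : Γ, ∀ z ∈ V, (g : 𝔻 ≃ₜ 𝔻) z ∈ W → LipschitzWith L (ρ g))
    {τ : 𝔻 → 𝔻} (hτ : IsHolo τ) {V : Set 𝔻} (hV : V ∈ F) (h0V : τ 0 ∈ V) (n : ℕ) :
    ∀ ξ : 𝔻, (1 + ‖(ξ : ℂ)‖) / (1 - ‖(ξ : ℂ)‖) ≤ ((1 + η) / (1 - η)) ^ n →
      ∀ W ∈ F, ∀ g : Γ, (g : 𝔻 ≃ₜ 𝔻) (τ ξ) ∈ W → LipschitzWith (L ^ (n + 1)) (ρ g) := by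
  induction n with
  | zero =>
    intro ξ hξ W hW g hg
    have hξ0 : ξ = 0 := by
      rw [pow_zero, div_le_one (sub_pos.2 ξ.norm_lt_one)] at hξ
      rw [← UnitDisc.coe_eq_zero, ← norm_le_zero_iff]
      linarith
    subst hξ0
    simpa using hL V hV W hW g _ h0V hg
  | succ n ih =>
    intro ξ hξ W hW g hg
    -- One step back along the radius: by Schwarz–Pick the box chosen around `τ ξ'` also contains
    -- the translate of `τ ξ`. So `g = (g g'⁻¹) g'`, where `g g'⁻¹` is a single change of box and
    -- `g'` is handled by induction.
    obtain ⟨ξ', hd, hξ'⟩ := exists_pseudoDist_le_radial h0 h1 n ξ hξ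
    obtain ⟨g', W', hW', hw⟩ := hcov (τ ξ')
    have e1 := ih ξ' hξ' W' hW' g' (hw _ (by simpa [pseudoDist_eq] using h0.le))
    have e2 := hL W' hW' W hW (g * g'⁻¹) _ (hw _ ((hτ.pseudoDist_le _ _).trans hd)) (by
      have : ((g * g'⁻¹ : Γ) : 𝔻 ≃ₜ 𝔻) ((g' : 𝔻 ≃ₜ 𝔻) (τ ξ)) = (g : 𝔻 ≃ₜ 𝔻) (τ ξ) :=
        congrArg (g : 𝔻 ≃ₜ 𝔻) ((g' : 𝔻 ≃ₜ 𝔻).symm_apply_apply _)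
      rwa [this])
    have e3 := e2.comp e1
    have : (ρ (g * g'⁻¹) : T → T) ∘ ρ g' = ρ g := by
      funext t
      change (ρ (g * g'⁻¹) * ρ g') t = ρ g t
      rw [← map_mul, inv_mul_cancel_right]
    rw [this, ← pow_succ'] at e3
    exact e3

/-! ### Bowen distance and entropy -/

/-- A deck transformation carries the centre of the chosen uniformization to `a`; what remains
undetermined is a rotation. -/
theorem exists_leafUnif_cls (hΓ : Γ ≤ discAut) (a : 𝔻) (t : T) :
    ∃ c : Circle, ∀ ξ, leafUnif Γ ρ (cls Γ ρ a t) ξ = cls Γ ρ (mobius a (c • ξ)) t := by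
  obtain ⟨⟨τ, hτ, t₁, h⟩, h0⟩ := leafUnif_spec Γ ρ (cls Γ ρ a t)
  rw [h] at h0
  obtain ⟨γ, ha, ht⟩ := exists_of_cls_eq h0
  obtain ⟨c, hc⟩ := exists_circle_eq_mobius (discAut.mul_mem (hΓ γ.2) hτ)
  refine ⟨c, fun ξ => ?_⟩
  have h0' : ((γ : 𝔻 ≃ₜ 𝔻) * τ) 0 = a := ha.symm
  rw [h, ← cls_apply_apply γ (τ ξ) t₁, ← ht, ← h0', ← hc]
  rfl

/-- The infimum over `θ` absorbs the rotations of both uniformizations, and the hyperbolic disc is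
rotation invariant, so Möbius translations suffice for upper bounds. -/
theorem bowenDist_cls_le (hΓ : Γ ≤ discAut) (d : Suspension Γ ρ → Suspension Γ ρ → ℝ≥0∞) (R : ℝ)
    {r : ℝ≥0∞} {a b : 𝔻} {t s : T}
    (h : ∀ ξ ∈ closedHypDisc R, d (cls Γ ρ (mobius a ξ) t) (cls Γ ρ (mobius b ξ) s) ≤ r) :
    bowenDist Γ ρ d R (cls Γ ρ a t) (cls Γ ρ b s) ≤ r := by
  obtain ⟨c, hc⟩ := exists_leafUnif_cls (ρ := ρ) hΓ a t
  obtain ⟨c', hc'⟩ := exists_leafUnif_cls (ρ := ρ) hΓ b s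
  refine iInf_le_of_le (arg (c'⁻¹ * c : Circle)) (iSup₂_le fun ξ hξ => ?_)
  rw [Circle.exp_arg, hc, hc', smul_smul, mul_inv_cancel_left]
  refine h _ ?_
  rw [closedHypDisc, Set.mem_ofPred_eq] at hξ ⊢
  rwa [UnitDisc.coe_circle_smul, norm_mul, Circle.norm_coe, one_mul]

/-- Take `j = ⌈R⌉₊`, at most `2R` for `R ≥ 1`; once `R ≥ log (D + 1)` the growth rate is at most `1
+ 2 log (B + 1)`. It is essential that `B` is fixed before `ε`; the added ones avoid `log 0`. -/
theorem hyperbolicEntropy_lt_top_of_coverNum_le (d : Suspension Γ ρ → Suspension Γ ρ → ℝ≥0∞)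
    (B : ℕ) (h : ∀ ε : ℝ, 0 < ε → ∃ D : ℕ, ∀ (j : ℕ) (R : ℝ), R ≤ j →
      coverNum Γ ρ d Set.univ R ε ≤ (D * B ^ j : ℕ)) :
    hyperbolicEntropy Γ ρ d < ⊤ := by
  set b : ℝ := 1 + 2 * Real.log (B + 1) with hb
  refine lt_of_le_of_lt (b := (b : EReal)) (iSup₂_le fun ε hε => ?_) (EReal.coe_lt_top _)
  obtain ⟨D, hD⟩ := h ε hε
  refine limsup_le_of_le (by isBoundedDefault) ?_
  filter_upwards [eventually_ge_atTop 1, eventually_ge_atTop (Real.log (D + 1))] with R hR1 hRD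
  have hR0 : 0 < R := by linarith
  rw [EReal.div_le_iff_le_mul (by exact_mod_cast hR0) (EReal.coe_ne_top R)]
  have hlogB : 0 ≤ Real.log (B + 1) := Real.log_nonneg (by simp)
  have hle : ((coverNum Γ ρ d Set.univ R ε : ℕ∞) : ℝ≥0∞) ≤ ENNReal.ofReal (Real.exp (R * b)) := by
    have h1 : ((coverNum Γ ρ d Set.univ R ε : ℕ∞) : ℝ≥0∞) ≤ ((D * B ^ ⌈R⌉₊ : ℕ) : ℝ≥0∞) := by
      exact_mod_cast hD ⌈R⌉₊ R (Nat.le_ceil R)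
    refine h1.trans ?_
    rw [← ENNReal.ofReal_natCast]
    refine ENNReal.ofReal_le_ofReal ?_
    have h2 : ((D * B ^ ⌈R⌉₊ : ℕ) : ℝ) ≤ (D + 1) * (B + 1) ^ ⌈R⌉₊ := by
      push_cast
      gcongr <;> simp
    refine h2.trans ?_
    rw [← Real.log_le_iff_le_exp (by positivity), Real.log_mul (by positivity) (by positivity),
      Real.log_pow]
    have h3 : (⌈R⌉₊ : ℝ) ≤ 2 * R := by linarith [Nat.ceil_lt_add_one hR0.le]
    nlinarith [mul_le_mul_of_nonneg_right h3 hlogB]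
  refine (ENNReal.log_monotone hle).trans_eq ?_
  rw [ENNReal.log_ofReal_of_pos (Real.exp_pos _), Real.log_exp, EReal.coe_mul]

end Holonomy

end HypSusp

end

/-! ### Products of small balls inside Bowen balls. -/

noncomputable section

namespace HypSusp

section Covering

variable {T : Type*} [MetricSpace T] {Γ : Subgroup (𝔻 ≃ₜ 𝔻)} {ρ : Γ →* (T ≃ₜ T)}

/-- Uniform continuity of a continuous map on the suspension, near a compact part of a fundamental
domain. -/
theorem exists_edist_cls_le [CompactSpace T] {M : Type*} [PseudoEMetricSpace M]
    {ι : Suspension Γ ρ → M} (hι : Continuous ι) {K : Set 𝔻} (hK : IsCompact K) {ε : ℝ≥0∞}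
    (hε : 0 < ε) :
    ∃ D : ℕ, 1 ≤ D ∧ ∀ z ∈ K, ∀ w : 𝔻, ∀ t s : T, ‖(z : ℂ) - w‖ ≤ (D : ℝ)⁻¹ →
      edist t s ≤ (D : ℝ≥0∞)⁻¹ → edist (ι (cls Γ ρ z t)) (ι (cls Γ ρ w s)) < ε := by
  let _ : MetricSpace 𝔻 := UnitDisc.isEmbedding_coe.comapMetricSpace _
  -- Only one of the two points has to lie over `K`; the other is arbitrary.
  have hu := (hK.prod (isCompact_univ (X := T))).uniformContinuousAt_of_continuousAt
    (fun p : 𝔻 × T => ι (cls Γ ρ p.1 p.2)) (fun p _ => (hι.comp continuous_cls).continuousAt)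
    (edist_mem_uniformity hε)
  obtain ⟨δ, hδ, h⟩ := Metric.mem_uniformity_dist.1 hu
  obtain ⟨n, hn⟩ := exists_nat_one_div_lt hδ
  refine ⟨n + 1, by simp, fun z hz w t s hzw hts => ?_⟩
  have hn' : ((n + 1 : ℕ) : ℝ)⁻¹ < δ := by simpa using hn
  refine h (a := (z, t)) (b := (w, s)) ?_ ⟨hz, Set.mem_univ _⟩
  have h1 : dist z w = ‖(z : ℂ) - w‖ := dist_eq_norm (z : ℂ) w
  have h2 : dist t s ≤ ((n + 1 : ℕ) : ℝ)⁻¹ := by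
    rw [dist_edist]
    refine (ENNReal.toReal_mono (by simp) hts).trans_eq ?_
    rw [ENNReal.toReal_inv, ENNReal.toReal_natCast]
  rw [Prod.dist_eq, max_lt_iff, h1]
  exact ⟨hzw.trans_lt hn', h2.trans_lt hn'⟩

/-- The Bowen balls of radius `R` contain products of balls whose radii decrease exponentially
with `R`. -/
theorem exists_bowenDist_cls_lt [CompactSpace T] [Nonempty T] (hΓ : IsSurfaceGroup Γ)
    (hLip : IsLipschitzSuspension Γ ρ) {M : Type*} [PseudoEMetricSpace M]
    {ι : Suspension Γ ρ → M} (hι : Continuous ι) :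
    ∃ (S : Set 𝔻) (B : ℕ), 1 ≤ B ∧ (∀ z : 𝔻, ∃ g : Γ, (g : 𝔻 ≃ₜ 𝔻) z ∈ S) ∧
      ∀ ε : ℝ, 0 < ε → ∃ D : ℕ, 1 ≤ D ∧ ∀ (j : ℕ) (R : ℝ), R ≤ j →
        ∀ a ∈ S, ∀ b : 𝔻, ∀ t s : T, ‖(a : ℂ) - b‖ ≤ ((D * B ^ j : ℕ) : ℝ)⁻¹ →
          edist t s ≤ ((D * B ^ j : ℕ) : ℝ≥0∞)⁻¹ →
          bowenDist Γ ρ (fun x y => edist (ι x) (ι y)) R (cls Γ ρ a t) (cls Γ ρ b s) <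
            ENNReal.ofReal ε := by
  obtain ⟨F, L, K, η, hL1, hK, h0, h1, hcov, hL⟩ := exists_finset_flowBase hΓ hLip
  obtain ⟨κ, hκ0, hκ⟩ : ∃ κ : ℝ, 0 < κ ∧ ∀ a ∈ K, κ ≤ 1 - ‖(a : ℂ)‖ :=
    hK.exists_forall_le' (continuous_const.sub UnitDisc.continuous_coe.norm).continuousOn
      fun a _ => sub_pos.2 a.norm_lt_one
  obtain ⟨k, hk⟩ := exists_nat_ge (64 / κ + 1)
  have hk1 : 1 ≤ k := by
    have : (1 : ℝ) ≤ k := le_trans (le_add_of_nonneg_left (div_pos (by norm_num) hκ0).le) hk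
    exact_mod_cast this
  have hq : 1 < (1 + η) / (1 - η) := by rw [one_lt_div (by linarith)]; linarith
  -- `N` steps of size `η` cover one unit of hyperbolic length.
  obtain ⟨N, hN⟩ := pow_unbounded_of_one_lt (Real.exp 1) hq
  have hexp : Real.exp 1 ≤ 3 := by linarith [Real.exp_one_lt_d9]
  -- Per unit of length, holonomy costs `L ^ N` and the leaf direction at most `27 = 3 ^ 3`, a bound
  -- for `exp 3`.
  refine ⟨{z ∈ K | ∃ V ∈ F, z ∈ V}, L ^ N * 27, ?_, fun z => ?_, fun ε hε => ?_⟩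
  · have := Nat.one_le_pow N L hL1
    omega
  · obtain ⟨g, hg, V, hV, h⟩ := hcov z
    exact ⟨g, hg, V, hV, h z (by simpa [pseudoDist_eq] using h0.le)⟩
  obtain ⟨D, hD1, hD⟩ := exists_edist_cls_le hι hK (ENNReal.ofReal_pos.2 (half_pos hε))
  -- `D` comes from uniform continuity, `k` absorbs `64 / κ` in the leaf direction, and `L` pays for
  -- the extra `+ 1` in the holonomy exponent.
  refine ⟨D * k * L, Nat.mul_pos (Nat.mul_pos hD1 hk1) hL1, ?_⟩
  rintro j R hRj a ⟨haK, V, hV, haV⟩ b t s hab hts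
  refine lt_of_le_of_lt (bowenDist_cls_le hΓ.le_discAut _ R fun ξ hξ => (?_ : _ ≤ _))
    (ENNReal.ofReal_lt_ofReal_iff hε |>.2 (half_lt_self hε))
  have hr : 0 < 1 - ‖(ξ : ℂ)‖ := sub_pos.2 ξ.norm_lt_one
  have hrj : (1 + ‖(ξ : ℂ)‖) / (1 - ‖(ξ : ℂ)‖) ≤ Real.exp 1 ^ j := by
    rw [← Real.exp_nat_mul, mul_one, ← Real.log_le_iff_le_exp (by positivity)]
    exact le_trans hξ hRj
  obtain ⟨g, hgK, W, hW, hgW⟩ := hcov (mobius a ξ)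
  have hlip := lipschitzWith_holonomy h0 h1 (fun z => (hcov z).imp fun g hg => hg.2) hL
    (isHolo_mobius a) hV (by rwa [mobius_zero_right]) (N * j) ξ
    (hrj.trans (by rw [pow_mul]; gcongr)) W hW g
    (hgW _ (by simpa [pseudoDist_eq] using h0.le))
  -- The same `g` moves both points, bringing the first over `K` without changing the classes.
  rw [← cls_apply_apply g (mobius a ξ) t, ← cls_apply_apply g (mobius b ξ) s]
  refine (hD _ hgK _ _ _ ?_ ?_).le
  · have hinv : (1 - ‖(ξ : ℂ)‖)⁻¹ ≤ 3 ^ j := by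
      refine le_trans ?_ (hrj.trans (by gcongr))
      rw [inv_eq_one_div]
      gcongr
      simp
    have e1 := norm_sub_le_two_mul_pseudoDist ((g : 𝔻 ≃ₜ 𝔻) (mobius b ξ)) ((g : 𝔻 ≃ₜ 𝔻) (mobius a ξ))
    have e2 := (hΓ.le_discAut g.2).1.pseudoDist_le (mobius b ξ) (mobius a ξ)
    have e3 := pseudoDist_mobius_mobius_le a b ξ
    rw [norm_sub_rev]
    calc _ ≤ 2 * (32 * ‖(a : ℂ) - b‖ / ((1 - ‖(a : ℂ)‖) * (1 - ‖(ξ : ℂ)‖) ^ 3)) := by linarith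
      _ = 64 * (1 - ‖(a : ℂ)‖)⁻¹ * ((1 - ‖(ξ : ℂ)‖)⁻¹) ^ 3 * ‖(a : ℂ) - b‖ := by
        rw [div_eq_mul_inv, mul_inv, inv_pow]; ring
      _ ≤ 64 * κ⁻¹ * (3 ^ j) ^ 3 * ((D * k * L * (L ^ N * 27) ^ j : ℕ) : ℝ)⁻¹ := by
        gcongr
        exact hκ a haK
      _ ≤ k * 27 ^ j * ((D * k * 27 ^ j : ℕ) : ℝ)⁻¹ := by
        rw [← pow_mul, mul_comm j 3, pow_mul]
        have e4 : 64 * κ⁻¹ ≤ k := by rw [← div_eq_mul_inv]; linarith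
        have e5 : D * k * 27 ^ j ≤ D * k * L * (L ^ N * 27) ^ j := by
          rw [mul_pow, mul_assoc (D * k), ← mul_assoc L]
          refine Nat.mul_le_mul_left _ (Nat.le_mul_of_pos_left _ ?_)
          positivity
        have e6 : 0 < D * k * 27 ^ j := by positivity
        gcongr
        norm_num
      _ = (D : ℝ)⁻¹ := by
        have : (k : ℝ) ≠ 0 := by positivity
        push_cast
        field_simp
  · refine (hlip t s).trans ((mul_le_mul_right hts _).trans ?_)
    have e5 : L ^ (N * j + 1) * D ≤ D * k * L * (L ^ N * 27) ^ j := by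
      calc L ^ (N * j + 1) * D = D * 1 * L * (L ^ N * 1) ^ j := by rw [pow_succ, pow_mul]; ring
        _ ≤ _ := by gcongr; norm_num
    have hp : L ^ (N * j + 1) ≠ 0 := by positivity
    calc _ ≤ ((L ^ (N * j + 1) : ℕ) : ℝ≥0∞) * ((L ^ (N * j + 1) * D : ℕ) : ℝ≥0∞)⁻¹ := by
          have e6 : ((L ^ (N * j + 1) * D : ℕ) : ℝ≥0∞) ≤ (D * k * L * (L ^ N * 27) ^ j : ℕ) := by
            exact_mod_cast e5
          refine mul_le_mul' (le_of_eq (by push_cast; rfl)) (ENNReal.inv_le_inv.2 e6)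
      _ = _ := by
        rw [Nat.cast_mul, ENNReal.mul_inv (by simp) (by simp), ← mul_assoc,
          ENNReal.mul_inv_cancel (by exact_mod_cast hp) (by simp), one_mul]

end Covering

end HypSusp

end

/-! ### Counting Bowen balls. -/

theorem mainTheorem10 {T : Type*} [MetricSpace T] [CompactSpace T]
    (Γ : Subgroup (𝔻 ≃ₜ 𝔻)) (hΓ : HypSusp.IsSurfaceGroup Γ) (ρ : Γ →* (T ≃ₜ T))
    -- the ambient Riemannian manifold and the embedding
    {n : ℕ} {M : Type*} [EMetricSpace M] [ChartedSpace (EuclideanSpace ℝ (Fin n)) M]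
    [IsManifold (𝓡 n) ∞ M] [RiemannianBundle (fun x : M => TangentSpace (𝓡 n) x)]
    [IsContMDiffRiemannianBundle (𝓡 n) ∞ (EuclideanSpace ℝ (Fin n))
      (fun x : M => TangentSpace (𝓡 n) x)]
    [IsRiemannianManifold (𝓡 n) M]
    (ι : HypSusp.Suspension Γ ρ → M) (hι : IsEmbedding ι)
    -- the metric of `T` is controlled by the one of the distinguished transversal `[{0} × T]`
    (C : ℝ≥0) (hT : AntilipschitzWith C (fun t : T => ι (HypSusp.cls Γ ρ 0 t)))
    (hLip : HypSusp.IsLipschitzSuspension Γ ρ) :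
    HypSusp.hyperbolicEntropy Γ ρ (fun x y => edist (ι x) (ι y)) < ⊤ := by
  classical
  rcases isEmpty_or_nonempty T with hTe | hTn
  · refine HypSusp.hyperbolicEntropy_lt_top_of_coverNum_le _ 0 fun ε _ => ⟨0, fun j R _ => ?_⟩
    refine iInf₂_le_of_le ∅ (fun y => ?_) (by simp)
    obtain ⟨p, -⟩ := Quotient.exists_rep y
    exact hTe.elim p.2
  obtain ⟨S, B, hB, hS, hball⟩ := HypSusp.exists_bowenDist_cls_lt hΓ hLip hι.continuous
  obtain ⟨A, k, hA⟩ := exists_cover_of_edist_le (S := S) (f := fun z : 𝔻 => (z : ℂ))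
    (e := fun z w : 𝔻 => edist (z : ℂ) (w : ℂ)) (c := 1)
    (Metric.isBounded_ball.subset (t := Metric.ball (0 : ℂ) 1)
      (by rintro _ ⟨z, -, rfl⟩; simpa using z.norm_lt_one)) (by simp)
  have : IsContinuousRiemannianBundle (EuclideanSpace ℝ (Fin n))
      (fun x : M => TangentSpace (𝓡 n) x) := by
    obtain ⟨g, hg, h⟩ := IsContMDiffRiemannianBundle.exists_contMDiff (IB := 𝓡 n) (n := ∞)
      (F := EuclideanSpace ℝ (Fin n)) (E := fun x : M => TangentSpace (𝓡 n) x)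
    exact ⟨g, hg.continuous, h⟩
  obtain ⟨A', k', hA'⟩ := hasPolynomialCover_univ_of_antilipschitzWith (𝓡 n)
    (hι.continuous.comp (HypSusp.continuous_cls.comp (Continuous.prodMk_right (0 : 𝔻)))) hT
  -- At scale `1 / m` with `m = D * B ^ j`, the disc factor needs `A * m ^ k` centres and `T` needs
  -- `A' * m ^ k'`; the product grows in `j` like `(B ^ (k + k')) ^ j`.
  refine HypSusp.hyperbolicEntropy_lt_top_of_coverNum_le _ (B ^ (k + k')) fun ε hε => ?_
  obtain ⟨D, hD, hb⟩ := hball ε hε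
  refine ⟨A * A' * D ^ (k + k'), fun j R hR => ?_⟩
  have hm : 1 ≤ D * B ^ j := Nat.mul_pos hD (Nat.pow_pos hB)
  obtain ⟨G, hGS, hGc, hG⟩ := hA _ hm
  obtain ⟨G', hGc', hG'⟩ := hA' _ hm
  refine iInf₂_le_of_le ((G ×ˢ G').image fun p => HypSusp.cls Γ ρ p.1 p.2) (fun y _ => ?_) ?_
  · obtain ⟨⟨z, t⟩, rfl⟩ := Quotient.exists_rep y
    obtain ⟨g, hg⟩ := hS z
    obtain ⟨a, ha, hab⟩ := hG _ hg
    obtain ⟨s, hs, hst⟩ := hG' (ρ g t) (Set.mem_univ _)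
    refine ⟨_, Finset.mem_image_of_mem _ (Finset.mk_mem_product ha hs), ?_⟩
    have := hb j R hR a (hGS a ha) _ s (ρ g t) (by
      rw [← dist_eq_norm, dist_edist]
      refine (ENNReal.toReal_mono ?_ hab).trans_eq (by simp)
      exact ENNReal.inv_ne_top.2 (by exact_mod_cast Nat.one_le_iff_ne_zero.1 hm)) hst
    rwa [HypSusp.cls_apply_apply] at this
  · refine Nat.cast_le.2 (Finset.card_image_le.trans ?_)
    rw [Finset.card_product]
    refine (Nat.mul_le_mul hGc hGc').trans_eq ?_
    ring
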